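/- **Lemma (Linearized operator of the soliton equation).** Let $\Sigma$ be a smooth $n$-dimensional manifold, let $F:\Sigma\to\mathbb{R}^{n+1}$ be a smooth immersion, and let $\nu:\Sigma\to\mathbb{R}^{n+1}$ be a continuous unit normal vector field along $F$. Let $\nabla_\Sigma$, $\operatorname{div}_\Sigma$ and $\Delta_\Sigma$ denote the gradient, the surface divergence and the Laplace–Beltrami operator of the metric induced by $F$, let $A$ be the second fundamental form and $H=-\operatorname{div}_\Sigma\nu$ the scalar mean curvature. Suppose that $F$ is a self-expander to the inverse mean curvature flow, that is, $H\neq 0$ everywhere on $\Sigma$ and, for some constant $C>0$, $$-\frac{1}{H}=C\,\langle F,\nu\rangle\quad\text{on }\Sigma .$$ For smooth $\varphi:\Sigma\to\mathbb{R}$ put $$\mathcal{L}_\Sigma\varphi:=\Delta_\Sigma\varphi+CH^2\langle F,\nabla_\Sigma\varphi\rangle+\left(|A|^2-CH^2\right)\varphi .$$ Then: 1. For every rotation vector field $R$ on $\mathbb{R}^{n+1}$ about the origin (that is, $\partial_t\psi_t=R\circ\psi_t$ for a one-parameter family $(\psi_t)_{t\in\mathbb{R}}$ of rotations of $\mathbb{R}^{n+1}$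 fixing the origin, with $\psi_0=\mathrm{id}$; this includes the rotations about any axis through the origin), the rotation function $\langle R\circ F,\nu\rangle:\Sigma\to\mathbb{R}$ is smooth and satisfies $\mathcal{L}_\Sigma\langle R\circ F,\nu\rangle=0$ on $\Sigma$. 2. The support function $\langle F,\nu\rangle:\Sigma\to\mathbb{R}$ is smooth and satisfies $\mathcal{L}_\Sigma\langle F,\nu\rangle=0$ on $\Sigma$. -/

import Mathlib

open scoped Manifold ContDiff RealInnerProductSpace

noncomputable section

namespace ImmersedHypersurface

/-- The ambient Euclidean space `ℝ^(n+1)`. -/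
abbrev Ambient (n : ℕ) : Type := EuclideanSpace ℝ (Fin (n + 1))

section Geometry

variable {n : ℕ} {M : Type*} [TopologicalSpace M] [ChartedSpace (EuclideanSpace ℝ (Fin n)) M]

/-- The derivative at `p` of a vector-valued function `X` on the `n`-manifold `M` in the direction
of the `i`-th vector `e_i` of the standard basis of the tangent space `T_p M` (the coordinate basis
of the chart at `p`). The quantities below are all independent of the choice of the basis. -/
def partialD {W : Type*} [NormedAddCommGroup W] [NormedSpace ℝ W] (X : M → W) (p : M)
    (i : Fin n) : W :=
  mfderiv (𝓡 n) 𝓘(ℝ, W) X p (EuclideanSpace.single i (1 : ℝ) : EuclideanSpace ℝ (Fin n))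

/-- `F` is a smooth immersion: it is `C^∞` and its differential is injective at every point. -/
def IsSmoothImmersion (F : M → Ambient n) : Prop :=
  ContMDiff (𝓡 n) 𝓘(ℝ, Ambient n) ∞ F ∧
    ∀ p : M, Function.Injective (mfderiv (𝓡 n) 𝓘(ℝ, Ambient n) F p)

/-- `ν` is a continuous unit normal vector field along `F`. -/
def IsUnitNormal (F ν : M → Ambient n) : Prop :=
  Continuous ν ∧ (∀ p : M, ‖ν p‖ = 1) ∧
    ∀ (p : M) (v : TangentSpace (𝓡 n) p),
      @inner ℝ (Ambient n) _ (mfderiv (𝓡 n) 𝓘(ℝ, Ambient n) F p v) (ν p) = 0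

/-- The matrix `g_ij = ⟨∂_i F, ∂_j F⟩` of the metric induced by `F`. -/
def metric (F : M → Ambient n) (p : M) : Matrix (Fin n) (Fin n) ℝ :=
  Matrix.of fun i j => ⟪partialD F p i, partialD F p j⟫

/-- The surface divergence `div_Σ X = ∑ g^{ij} ⟨∂_i X, ∂_j F⟩` of an `ℝ^(n+1)`-valued vector field
along `F`: the trace over the tangent space of the tangential part of `dX`. For tangential `X` it is
the intrinsic divergence of the induced metric. -/
def surfaceDiv (F X : M → Ambient n) (p : M) : ℝ :=
  ∑ i, ∑ j, (metric F p)⁻¹ i j * ⟪partialD X p i, partialD F p j⟫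

/-- The gradient `∇_Σ φ = ∑ g^{ij} (∂_i φ) ∂_j F`, as a vector field along `F` tangent to `F`. -/
def surfaceGrad (F : M → Ambient n) (φ : M → ℝ) (p : M) : Ambient n :=
  ∑ i, ∑ j, ((metric F p)⁻¹ i j * partialD φ p i) • partialD F p j

/-- The Laplace-Beltrami operator `Δ_Σ φ = div_Σ (∇_Σ φ)` of the induced metric. -/
def laplaceBeltrami (F : M → Ambient n) (φ : M → ℝ) (p : M) : ℝ :=
  surfaceDiv F (surfaceGrad F φ) p

/-- The scalar mean curvature `H = - div_Σ ν`. -/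
def meanCurvature (F ν : M → Ambient n) (p : M) : ℝ :=
  -surfaceDiv F ν p

/-- The coefficients `h_ij = - ⟨∂_i ν, ∂_j F⟩` of the second fundamental form `A`. -/
def secondFF (F ν : M → Ambient n) (p : M) : Matrix (Fin n) (Fin n) ℝ :=
  Matrix.of fun i j => -⟪partialD ν p i, partialD F p j⟫

/-- The squared norm `|A|² = ∑ g^{ik} g^{jl} h_ij h_kl` of the second fundamental form. -/
def normSqA (F ν : M → Ambient n) (p : M) : ℝ :=
  ∑ i, ∑ j, ∑ k, ∑ l,
    (metric F p)⁻¹ i k * (metric F p)⁻¹ j l * secondFF F ν p i j * secondFF F ν p k l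

/-- The immersed hypersurface `F` with unit normal `ν` satisfies the self-expander equation
`-1/H = C ⟨F, ν⟩` of the inverse mean curvature flow, with `H` nowhere zero. -/
structure IsSelfExpander (C : ℝ) (F ν : M → Ambient n) : Prop where
  immersion : IsSmoothImmersion F
  unitNormal : IsUnitNormal F ν
  meanCurvature_ne_zero : ∀ p : M, meanCurvature F ν p ≠ 0
  equation : ∀ p : M, -1 / meanCurvature F ν p = C * ⟪F p, ν p⟫

/-- The operator `L_Σ φ = Δ_Σ φ + C H² ⟨F, ∇_Σ φ⟩ + (|A|² - C H²) φ`. -/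
def solitonOperator (C : ℝ) (F ν : M → Ambient n) (φ : M → ℝ) (p : M) : ℝ :=
  laplaceBeltrami F φ p + C * meanCurvature F ν p ^ 2 * ⟪F p, surfaceGrad F φ p⟫
    + (normSqA F ν p - C * meanCurvature F ν p ^ 2) * φ p

/-- `φ` is a smooth function on `M` with `L_Σ φ = 0`. -/
def InKernel (C : ℝ) (F ν : M → Ambient n) (φ : M → ℝ) : Prop :=
  ContMDiff (𝓡 n) 𝓘(ℝ, ℝ) ∞ φ ∧ ∀ p : M, solitonOperator C F ν φ p = 0

end Geometry

/-- `R` is a rotation vector field on `ℝ^(n+1)`: it generates a one-parameter family `ψ_t` of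
rotations fixing the origin, `ψ_0 = id` and `∂_t ψ_t = R ∘ ψ_t`. (The `ψ_t` are linear isometries,
and have determinant `1` because `ψ` is continuous in `t` and starts at the identity.) -/
def IsRotationField {n : ℕ} (R : Ambient n → Ambient n) : Prop :=
  ∃ ψ : ℝ → (Ambient n ≃ₗᵢ[ℝ] Ambient n),
    ψ 0 = LinearIsometryEquiv.refl ℝ (Ambient n) ∧
      ∀ (t : ℝ) (x : Ambient n), HasDerivAt (fun s : ℝ => ψ s x) (R (ψ t x)) t

end ImmersedHypersurface

end

/-! Both parts are one statement about a linear map `T` with `⟪T y, y⟫ = lam * ⟪y, y⟫`, that is,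
`lam` times the identity plus a skew map. Its flow consists of similarities fixing the origin; these
scale `-1/H` and `⟪F, ν⟫` by the same factor, so they carry self-expanders to self-expanders. The
normal speed `⟪T F, ν⟫` of this deformation should therefore solve the linearized equation.
Rotations have `lam = 0`, dilations have `T = id` and `lam = 1`.

The proof verifies this by direct computation instead of differentiating the flow. At a fixed point,
choose a constant linear change of coordinates making the coordinate frame orthonormal there; its
directional derivatives still commute. In `Δ⟪T F, ν⟫` four facts enter: the normal part of `∑ ∂_i∂_i
F` is `H ν`; the symmetric shape operator sees only the `lam` part of `T`; the normal part of `∑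
∂_i∂_i ν` is `-|A|² ν`; and by Codazzi its tangential part involves `-∇H`. The differentiated
soliton equation turns `∇H` into the term that the drift `C H² ⟪F, ∇φ⟫` cancels. What remains is
`-lam * H * (C * H * ⟪F, ν⟫ + 1)`, which is zero.

`soliton_identity` is this algebra, and `local_soliton` supplies its inputs by calculus.
`contDiffAt_unitNormal` upgrades the merely continuous normal to a smooth one. The reframing lemmas
carry the geometric operators from the manifold to a single chart. -/

noncomputable section

namespace ImmersedHypersurface

/-! ### Linear algebra of frames: change of frame, orthonormal frames, the pointwise identity -/

section Frames

variable {ι V : Type*} [Fintype ι] [DecidableEq ι] [NormedAddCommGroup V] [InnerProductSpace ℝ V]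

/-- The change of frame `a'_i = ∑ J_ki a_k`. -/
def reframe {W : Type*} [AddCommGroup W] [Module ℝ W] (J : Matrix ι ι ℝ) (a : ι → W) (i : ι) : W :=
  ∑ k, J k i • a k

/-- The matrix `⟪x_i, a_j⟫`. -/
def pairing (x a : ι → V) : Matrix ι ι ℝ := Matrix.of fun i j => ⟪x i, a j⟫

/-- The trace of `a_i ↦ x_i`, tangential part, with respect to the frame `a`. -/
def frameDiv (a x : ι → V) : ℝ :=
  ∑ i, ∑ j, (Matrix.gram ℝ a)⁻¹ i j * ⟪x i, a j⟫

/-- The vector in the span of the frame `a` whose inner products with the `a_i` are the `c_i`. -/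
def frameGrad (a : ι → V) (c : ι → ℝ) : V :=
  ∑ i, ∑ j, ((Matrix.gram ℝ a)⁻¹ i j * c i) • a j

/-- The squared norm of the bilinear form with matrix `-⟪x_i, a_j⟫` in the frame `a`. -/
def frameNormSq (a x : ι → V) : ℝ :=
  ∑ i, ∑ j, ∑ k, ∑ l, (Matrix.gram ℝ a)⁻¹ i k * (Matrix.gram ℝ a)⁻¹ j l *
    (-⟪x i, a j⟫) * (-⟪x k, a l⟫)

omit [DecidableEq ι] in
lemma pairing_reframe (J : Matrix ι ι ℝ) (x a : ι → V) :
    pairing (reframe J x) (reframe J a) = J.transpose * pairing x a * J := by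
  ext i j
  simp only [pairing, reframe, Matrix.of_apply, Matrix.mul_apply, Matrix.transpose_apply,
    sum_inner, inner_sum, real_inner_smul_left, real_inner_smul_right, Finset.sum_mul]
  refine Finset.sum_congr rfl fun k _ => Finset.sum_congr rfl fun l _ => by ring

omit [DecidableEq ι] in
lemma gram_reframe (J : Matrix ι ι ℝ) (a : ι → V) :
    Matrix.gram ℝ (reframe J a) = J.transpose * Matrix.gram ℝ a * J :=
  pairing_reframe J a a

lemma frameDiv_eq_trace (a x : ι → V) :
    frameDiv a x = ((Matrix.gram ℝ a)⁻¹ * (pairing x a).transpose).trace := by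
  simp [frameDiv, pairing, Matrix.trace, Matrix.mul_apply]

lemma frameNormSq_eq_trace (a x : ι → V) :
    frameNormSq a x = ((Matrix.gram ℝ a)⁻¹ * pairing x a *
      (Matrix.gram ℝ a)⁻¹.transpose * (pairing x a).transpose).trace := by
  simp only [frameNormSq, pairing, Matrix.trace, Matrix.mul_apply, Matrix.diag, Finset.sum_mul,
    Matrix.transpose_apply, Matrix.of_apply]
  refine Finset.sum_congr rfl fun i _ => Finset.sum_congr rfl fun j _ => ?_
  rw [Finset.sum_comm]
  refine Finset.sum_congr rfl fun i _ => Finset.sum_congr rfl fun j _ => by ring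

variable {J : Matrix ι ι ℝ}

/-- The Gram matrix and the pairing both transform by congruence, so the product under the trace is
only conjugated, and the trace is cyclic. The same mechanism gives `frameNormSq_reframe`. -/
lemma frameDiv_reframe (hJ : IsUnit J.det) (a x : ι → V) :
    frameDiv (reframe J a) (reframe J x) = frameDiv a x := by
  have hJ' : IsUnit J.transpose.det := by rwa [Matrix.det_transpose]
  rw [frameDiv_eq_trace, frameDiv_eq_trace, gram_reframe, pairing_reframe, Matrix.mul_inv_rev,
    Matrix.mul_inv_rev]
  simp only [Matrix.transpose_mul, Matrix.transpose_transpose, Matrix.mul_assoc]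
  rw [Matrix.nonsing_inv_mul_cancel_left _ _ hJ', Matrix.trace_mul_comm]
  simp only [Matrix.mul_assoc]
  rw [Matrix.mul_nonsing_inv _ hJ, Matrix.mul_one]

lemma frameNormSq_reframe (hJ : IsUnit J.det) (a x : ι → V) :
    frameNormSq (reframe J a) (reframe J x) = frameNormSq a x := by
  have hJ' : IsUnit J.transpose.det := by rwa [Matrix.det_transpose]
  rw [frameNormSq_eq_trace, frameNormSq_eq_trace, gram_reframe, pairing_reframe,
    Matrix.mul_inv_rev, Matrix.mul_inv_rev]
  simp only [Matrix.transpose_mul, Matrix.transpose_transpose, Matrix.mul_assoc,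
    Matrix.transpose_nonsing_inv]
  rw [Matrix.nonsing_inv_mul_cancel_left _ _ hJ', Matrix.mul_nonsing_inv_cancel_left _ _ hJ,
    Matrix.nonsing_inv_mul_cancel_left _ _ hJ', Matrix.trace_mul_comm]
  simp only [Matrix.mul_assoc]
  rw [Matrix.mul_nonsing_inv _ hJ, Matrix.mul_one]

lemma frameGrad_eq (a : ι → V) (c : ι → ℝ) :
    frameGrad a c = ∑ j, Matrix.vecMul c (Matrix.gram ℝ a)⁻¹ j • a j := by
  simp only [frameGrad, Matrix.vecMul, dotProduct, Finset.sum_smul]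
  rw [Finset.sum_comm]
  simp only [mul_comm]

lemma frameGrad_reframe (hJ : IsUnit J.det) (a : ι → V) (c : ι → ℝ) :
    frameGrad (reframe J a) (reframe J c) = frameGrad a c := by
  have hc : reframe J c = Matrix.vecMul c J := by
    ext i; simp [reframe, Matrix.vecMul, dotProduct, mul_comm]
  rw [frameGrad_eq, frameGrad_eq, hc, gram_reframe, Matrix.mul_inv_rev, Matrix.mul_inv_rev,
    Matrix.vecMul_vecMul, Matrix.mul_nonsing_inv_cancel_left _ _ hJ, ← Matrix.vecMul_vecMul]
  set v := Matrix.vecMul c (Matrix.gram ℝ a)⁻¹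
  have hJ' : IsUnit J.transpose.det := by rwa [Matrix.det_transpose]
  have key : Matrix.vecMul (Matrix.vecMul v J.transpose⁻¹) J.transpose = v := by
    rw [Matrix.vecMul_vecMul, Matrix.nonsing_inv_mul _ hJ', Matrix.vecMul_one]
  conv_rhs => rw [← key]
  simp only [reframe, Finset.smul_sum, smul_smul]
  rw [Finset.sum_comm]
  refine Finset.sum_congr rfl fun k _ => ?_
  rw [← Finset.sum_smul]
  rfl

/-- This defining property allows the gradient field to be differentiated without differentiating
the inverse metric. -/
lemma inner_frameGrad {a : ι → V} (ha : IsUnit (Matrix.gram ℝ a).det) (c : ι → ℝ) (j : ι) :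
    ⟪frameGrad a c, a j⟫ = c j := by
  have key : Matrix.vecMul (Matrix.vecMul c (Matrix.gram ℝ a)⁻¹) (Matrix.gram ℝ a) = c := by
    rw [Matrix.vecMul_vecMul, Matrix.nonsing_inv_mul _ ha, Matrix.vecMul_one]
  conv_rhs => rw [← key]
  rw [frameGrad_eq, sum_inner]
  simp only [real_inner_smul_left]
  rfl

lemma frameDiv_of_gram_eq_one {a : ι → V} (ha : Matrix.gram ℝ a = 1) (x : ι → V) :
    frameDiv a x = ∑ i, ⟪x i, a i⟫ := by
  simp [frameDiv, ha, Matrix.one_apply]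

lemma frameGrad_of_gram_eq_one {a : ι → V} (ha : Matrix.gram ℝ a = 1) (c : ι → ℝ) :
    frameGrad a c = ∑ i, c i • a i := by
  simp [frameGrad, ha, Matrix.one_apply]

lemma frameNormSq_of_gram_eq_one {a : ι → V} (ha : Matrix.gram ℝ a = 1) (x : ι → V) :
    frameNormSq a x = ∑ i, ∑ j, ⟪x i, a j⟫ ^ 2 := by
  simp [frameNormSq, ha, Matrix.one_apply, sq]

/-- The pointwise identity behind the two kernel elements of the linearized operator. The family
`a` is an orthonormal frame of the tangent space with unit normal `ν`, and `A2`, `N1`, `N2` stand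
for the derivatives `∂_i∂_j F`, `∂_i ν`, `∂_i∂_j ν`. -/
lemma soliton_identity {a N1 : ι → V} {A2 N2 : ι → ι → V} {ν x : V} {C H lam : ℝ} {dH : ι → ℝ}
    (T : V →L[ℝ] V) (hT : ∀ y, ⟪T y, y⟫ = lam * ⟪y, y⟫)
    (horth : Matrix.gram ℝ a = 1) (hν : ⟪ν, ν⟫ = 1)
    (hexp : ∀ y : V, y = ∑ k, ⟪y, a k⟫ • a k + ⟪y, ν⟫ • ν)
    (hN1 : ∀ i, ⟪N1 i, ν⟫ = 0) (hA2 : ∀ i j, ⟪A2 i j, ν⟫ = -⟪N1 i, a j⟫)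
    (hsymm : ∀ i j, ⟪N1 i, a j⟫ = ⟪N1 j, a i⟫)
    (hN2 : ∀ i, ⟪N2 i i, ν⟫ = -⟪N1 i, N1 i⟫)
    (hcod : ∀ i k, ⟪N2 i i, a k⟫ + ⟪N1 i, A2 i k⟫ = ⟪N2 i k, a i⟫ + ⟪N1 k, A2 i i⟫)
    (hH : H = -∑ i, ⟪N1 i, a i⟫)
    (hdH : ∀ k, dH k = ∑ i, (-⟪N2 i k, a i⟫ + ⟪N1 i, A2 i k⟫))
    (hsol : C * H * ⟪x, ν⟫ = -1) (hdsol : ∀ k, dH k = C * H ^ 2 * ⟪x, N1 k⟫) :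
    ∑ i, (⟪T (A2 i i), ν⟫ + 2 * ⟪T (a i), N1 i⟫ + ⟪T x, N2 i i⟫
        - ∑ k, (⟪T (a k), ν⟫ + ⟪T x, N1 k⟫) * ⟪a k, A2 i i⟫)
      + C * H ^ 2 * ∑ k, (⟪T (a k), ν⟫ + ⟪T x, N1 k⟫) * ⟪x, a k⟫
      + (∑ i, ∑ j, ⟪N1 i, a j⟫ ^ 2 - C * H ^ 2) * ⟪T x, ν⟫ = 0 := by
  have hpar : ∀ y z : V, ⟪y, z⟫ = ∑ k, ⟪y, a k⟫ * ⟪z, a k⟫ + ⟪y, ν⟫ * ⟪z, ν⟫ := by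
    intro y z
    conv_lhs => rw [hexp y]
    simp only [inner_add_left, sum_inner, real_inner_smul_left]
    simp only [real_inner_comm z]
  -- The hypothesis on `T` evaluates `⟪T ν, ν⟫` as `lam`; polarized, in `hT2`, it says that the
  -- symmetric part of `T` is `lam` times the identity.
  have hTexp : ∀ y : V, ⟪T y, ν⟫ = ∑ k, ⟪y, a k⟫ * ⟪T (a k), ν⟫ + ⟪y, ν⟫ * lam := by
    intro y
    conv_lhs => rw [hexp y]
    simp only [map_add, map_sum, map_smul, inner_add_left, sum_inner, real_inner_smul_left, hT ν,
      hν, mul_one]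
  have hT2 : ∀ y z : V, ⟪T y, z⟫ + ⟪T z, y⟫ = 2 * lam * ⟪y, z⟫ := by
    intro y z
    have h := hT (y + z)
    simp only [map_add, inner_add_left, inner_add_right, hT y, hT z] at h
    rw [real_inner_comm y z] at h
    linarith
  have ha : ∀ i j, ⟪a i, a j⟫ = if i = j then (1 : ℝ) else 0 := by
    intro i j
    have := congrFun (congrFun horth i) j
    simpa [Matrix.one_apply] using this
  set B : V := ∑ i, A2 i i with hB
  set M : V := ∑ i, N2 i i with hM
  have hBν : ⟪B, ν⟫ = H := by
    rw [hB, sum_inner, hH, ← Finset.sum_neg_distrib]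
    exact Finset.sum_congr rfl fun i _ => hA2 i i
  have hMν : ⟪M, ν⟫ = -∑ i, ∑ j, ⟪N1 i, a j⟫ ^ 2 := by
    rw [hM, sum_inner, ← Finset.sum_neg_distrib]
    refine Finset.sum_congr rfl fun i _ => ?_
    rw [hN2, hpar (N1 i) (N1 i), hN1]
    simp [sq]
  -- Traced Codazzi equation, in a frame whose Christoffel terms need not vanish.
  have hMa : ∀ k, ⟪M, a k⟫ = -dH k + ⟪N1 k, B⟫ := by
    intro k
    rw [hM, hB, sum_inner, inner_sum, hdH, ← Finset.sum_neg_distrib, ← Finset.sum_add_distrib]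
    refine Finset.sum_congr rfl fun i _ => ?_
    linarith [hcod i k]
  have hN1B : ∀ k, ⟪N1 k, B⟫ = ∑ j, ⟪N1 k, a j⟫ * ⟪B, a j⟫ := by
    intro k
    rw [hpar (N1 k) B, hN1]
    simp
  have hyN1 : ∀ (y : V) k, ⟪y, N1 k⟫ = ∑ j, ⟪y, a j⟫ * ⟪N1 k, a j⟫ := by
    intro y k
    rw [hpar y (N1 k), hN1]
    simp
  -- Trace of `T` against the symmetric shape operator: averaging the sum with its transpose leaves
  -- only the symmetric part of `T`.
  have hshape : ∑ i, ⟪T (a i), N1 i⟫ = -(lam * H) := by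
    have e1 : ∑ i, ⟪T (a i), N1 i⟫ = ∑ i, ∑ j, ⟪T (a i), a j⟫ * ⟪N1 i, a j⟫ :=
      Finset.sum_congr rfl fun i _ => hyN1 _ _
    have e2 : ∑ i, ⟪T (a i), N1 i⟫ = ∑ i, ∑ j, ⟪T (a j), a i⟫ * ⟪N1 i, a j⟫ := by
      rw [e1, Finset.sum_comm]
      refine Finset.sum_congr rfl fun i _ => Finset.sum_congr rfl fun j _ => ?_
      rw [hsymm j i]
    have e3 : 2 * ∑ i, ⟪T (a i), N1 i⟫ = 2 * (lam * ∑ i, ⟪N1 i, a i⟫) := by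
      rw [two_mul]
      nth_rewrite 1 [e1]
      rw [e2, ← Finset.sum_add_distrib, Finset.mul_sum, Finset.mul_sum]
      refine Finset.sum_congr rfl fun i _ => ?_
      rw [← Finset.sum_add_distrib]
      simp only [← add_mul, hT2, ha]
      simp
      ring
    rw [hH]; linarith
  have hTM : ⟪T x, M⟫ = -∑ k, dH k * ⟪T x, a k⟫ + ∑ k, ⟪N1 k, B⟫ * ⟪T x, a k⟫
      - (∑ i, ∑ j, ⟪N1 i, a j⟫ ^ 2) * ⟪T x, ν⟫ := by
    rw [hpar (T x) M, hMν]
    have : ∀ k, ⟪T x, a k⟫ * ⟪M, a k⟫ = -(dH k * ⟪T x, a k⟫) + ⟪N1 k, B⟫ * ⟪T x, a k⟫ := by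
      intro k; rw [hMa]; ring
    simp only [this, Finset.sum_add_distrib, Finset.sum_neg_distrib]
    ring
  have hswap : ∑ k, ⟪N1 k, B⟫ * ⟪T x, a k⟫ = ∑ k, ⟪T x, N1 k⟫ * ⟪B, a k⟫ := by
    simp only [hN1B, hyN1, Finset.sum_mul]
    rw [Finset.sum_comm]
    refine Finset.sum_congr rfl fun i _ => Finset.sum_congr rfl fun j _ => ?_
    rw [hsymm j i]; ring
  have hdHT : ∑ k, dH k * ⟪T x, a k⟫ = C * H ^ 2 * ∑ k, ⟪T x, N1 k⟫ * ⟪x, a k⟫ := by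
    simp only [hdsol, hyN1, Finset.mul_sum, Finset.sum_mul]
    rw [Finset.sum_comm]
    refine Finset.sum_congr rfl fun i _ => Finset.sum_congr rfl fun j _ => ?_
    rw [hsymm j i]; ring
  have hsum : ∑ i, (⟪T (A2 i i), ν⟫ + 2 * ⟪T (a i), N1 i⟫ + ⟪T x, N2 i i⟫
        - ∑ k, (⟪T (a k), ν⟫ + ⟪T x, N1 k⟫) * ⟪a k, A2 i i⟫)
      = ⟪T B, ν⟫ + 2 * ∑ i, ⟪T (a i), N1 i⟫ + ⟪T x, M⟫
        - ∑ k, (⟪T (a k), ν⟫ + ⟪T x, N1 k⟫) * ⟪B, a k⟫ := by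
    simp only [Finset.sum_sub_distrib, Finset.sum_add_distrib, hB, hM, map_sum, sum_inner,
      inner_sum, Finset.mul_sum]
    congr 1
    rw [Finset.sum_comm]
    refine Finset.sum_congr rfl fun i _ => Finset.sum_congr rfl fun j _ => ?_
    rw [real_inner_comm (a i)]
  rw [hsum, hTexp B, hBν, hshape, hTM, hswap, hdHT, hTexp x]
  simp only [add_mul, Finset.sum_add_distrib]
  have c1 : ∑ k, ⟪T (a k), ν⟫ * ⟪B, a k⟫ = ∑ k, ⟪B, a k⟫ * ⟪T (a k), ν⟫ := by
    simp only [mul_comm]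
  have c2 : ∑ k, ⟪T (a k), ν⟫ * ⟪x, a k⟫ = ∑ k, ⟪x, a k⟫ * ⟪T (a k), ν⟫ := by
    simp only [mul_comm]
  rw [c1, c2]
  -- All other terms cancel; the remainder is `-lam * H` times the soliton equation.
  linear_combination (-(lam * H)) * hsol

end Frames

/-! ### Calculus for a parametrized hypersurface in a vector space -/

section Local

open Filter Topology

variable {ι E V W : Type*} [NormedAddCommGroup E] [NormedSpace ℝ E]
  [NormedAddCommGroup V] [InnerProductSpace ℝ V] [NormedAddCommGroup W] [NormedSpace ℝ W]

/-- The derivative of `X` at `y` in the direction of the `i`-th vector of the family `b`. -/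
def dirD (b : ι → E) (X : E → W) (y : E) (i : ι) : W := fderiv ℝ X y (b i)

variable {b : ι → E} {x₀ : E}

lemma dirD_congr {X Y : E → W} (h : X =ᶠ[𝓝 x₀] Y) : dirD b X x₀ = dirD b Y x₀ := by
  funext i
  rw [dirD, dirD, h.fderiv_eq]

lemma dirD_const (c : W) : dirD b (fun _ => c) x₀ = 0 := by
  funext i
  simp [dirD]

lemma dirD_inner {X Y : E → V} (hX : DifferentiableAt ℝ X x₀) (hY : DifferentiableAt ℝ Y x₀)
    (i : ι) : dirD b (fun y => ⟪X y, Y y⟫) x₀ i = ⟪X x₀, dirD b Y x₀ i⟫ + ⟪dirD b X x₀ i, Y x₀⟫ :=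
  fderiv_inner_apply ℝ hX hY (b i)

lemma dirD_mul {X Y : E → ℝ} (hX : DifferentiableAt ℝ X x₀) (hY : DifferentiableAt ℝ Y x₀)
    (i : ι) : dirD b (fun y => X y * Y y) x₀ i = X x₀ * dirD b Y x₀ i + dirD b X x₀ i * Y x₀ := by
  rw [dirD, fderiv_fun_mul hX hY]
  simp [dirD, mul_comm]

lemma dirD_add {X Y : E → W} (hX : DifferentiableAt ℝ X x₀) (hY : DifferentiableAt ℝ Y x₀)
    (i : ι) : dirD b (fun y => X y + Y y) x₀ i = dirD b X x₀ i + dirD b Y x₀ i := by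
  rw [dirD, fderiv_fun_add hX hY]
  rfl

lemma dirD_neg (X : E → W) (i : ι) : dirD b (fun y => -X y) x₀ i = -dirD b X x₀ i := by
  rw [dirD, fderiv_fun_neg]
  rfl

lemma dirD_sum {κ : Type*} {s : Finset κ} {X : κ → E → W}
    (hX : ∀ k ∈ s, DifferentiableAt ℝ (X k) x₀) (i : ι) :
    dirD b (fun y => ∑ k ∈ s, X k y) x₀ i = ∑ k ∈ s, dirD b (X k) x₀ i := by
  rw [dirD, fderiv_fun_sum hX]
  simp [dirD]

lemma dirD_clm (T : V →L[ℝ] W) {X : E → V} (hX : DifferentiableAt ℝ X x₀) (i : ι) :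
    dirD b (fun y => T (X y)) x₀ i = T (dirD b X x₀ i) := by
  have := fderiv_fun_comp x₀ (T.differentiableAt (x := X x₀)) hX
  rw [dirD, this, ContinuousLinearMap.fderiv]
  rfl

lemma contDiffAt_dirD {m : ℕ∞ω} {X : E → W} (hX : ContDiffAt ℝ (m + 1) X x₀) (i : ι) :
    ContDiffAt ℝ m (fun y => dirD b X y i) x₀ :=
  (hX.fderiv_right le_rfl).clm_apply contDiffAt_const

lemma dirD_comm {X : E → W} (hX : ContDiffAt ℝ 2 X x₀) (i j : ι) :
    dirD b (fun y => dirD b X y i) x₀ j = dirD b (fun y => dirD b X y j) x₀ i := by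
  have hd : DifferentiableAt ℝ (fderiv ℝ X) x₀ :=
    (hX.fderiv_right (m := 1) le_rfl).differentiableAt one_ne_zero
  have hs : IsSymmSndFDerivAt ℝ X x₀ := hX.isSymmSndFDerivAt (by simp)
  have key : ∀ i j, dirD b (fun y => dirD b X y i) x₀ j = fderiv ℝ (fderiv ℝ X) x₀ (b j) (b i) := by
    intro i j
    simp only [dirD]
    rw [fderiv_clm_apply hd (differentiableAt_const _)]
    simp
  rw [key, key, hs.eq]

variable [Fintype ι] [DecidableEq ι]

lemma contDiffAt_matrix_det {m : ℕ∞ω} {A : E → Matrix ι ι ℝ}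
    (hA : ∀ i j, ContDiffAt ℝ m (fun y => A y i j) x₀) : ContDiffAt ℝ m (fun y => (A y).det) x₀ := by
  simp only [Matrix.det_apply]
  exact ContDiffAt.sum fun σ _ => (contDiffAt_prod fun i _ => hA _ _).const_smul _

lemma contDiffAt_matrix_inv {m : ℕ∞ω} {A : E → Matrix ι ι ℝ}
    (hA : ∀ i j, ContDiffAt ℝ m (fun y => A y i j) x₀) (hdet : (A x₀).det ≠ 0) (i j : ι) :
    ContDiffAt ℝ m (fun y => (A y)⁻¹ i j) x₀ := by
  simp only [Matrix.inv_def, Matrix.smul_apply, Ring.inverse_eq_inv', smul_eq_mul,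
    Matrix.adjugate_apply]
  refine ((contDiffAt_matrix_det hA).inv hdet).mul (contDiffAt_matrix_det fun k l => ?_)
  -- An adjugate entry is the determinant of the matrix with row `j` replaced by a constant vector.
  by_cases hk : k = j
  · subst hk
    simpa using contDiffAt_const
  · simpa [Matrix.updateRow_ne hk] using hA k l

lemma contDiffAt_gram_inv {m : ℕ∞ω} {f : E → V} (hf : ContDiffAt ℝ (m + 1) f x₀)
    (hdet : (Matrix.gram ℝ (dirD b f x₀)).det ≠ 0) (i j : ι) :
    ContDiffAt ℝ m (fun y => (Matrix.gram ℝ (dirD b f y))⁻¹ i j) x₀ :=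
  contDiffAt_matrix_inv (fun _ _ => (contDiffAt_dirD hf _).inner ℝ (contDiffAt_dirD hf _)) hdet i j

lemma eventually_gram_det_ne_zero {f : E → V} (hf : ContDiffAt ℝ 1 f x₀)
    (hdet : (Matrix.gram ℝ (dirD b f x₀)).det ≠ 0) :
    ∀ᶠ y in 𝓝 x₀, (Matrix.gram ℝ (dirD b f y)).det ≠ 0 := by
  have h : ContDiffAt ℝ 0 (fun y => (Matrix.gram ℝ (dirD b f y)).det) x₀ :=
    contDiffAt_matrix_det fun _ _ =>
      (contDiffAt_dirD (by simpa using hf) _).inner ℝ (contDiffAt_dirD (by simpa using hf) _)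
  exact h.continuousAt.eventually_ne hdet

lemma contDiffAt_frameGrad {m : ℕ∞ω} {f : E → V} (hf : ContDiffAt ℝ (m + 1) f x₀)
    (hdet : (Matrix.gram ℝ (dirD b f x₀)).det ≠ 0) {c : E → ι → ℝ}
    (hc : ∀ i, ContDiffAt ℝ m (fun y => c y i) x₀) :
    ContDiffAt ℝ m (fun y => frameGrad (dirD b f y) (c y)) x₀ :=
  ContDiffAt.sum fun _ _ => ContDiffAt.sum fun _ _ =>
    ((contDiffAt_gram_inv hf hdet _ _).mul (hc _)).smul (contDiffAt_dirD hf _)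

lemma contDiffAt_frameDiv {m : ℕ∞ω} {f N : E → V} (hf : ContDiffAt ℝ (m + 1) f x₀)
    (hN : ContDiffAt ℝ (m + 1) N x₀) (hdet : (Matrix.gram ℝ (dirD b f x₀)).det ≠ 0) :
    ContDiffAt ℝ m (fun y => frameDiv (dirD b f y) (dirD b N y)) x₀ :=
  ContDiffAt.sum fun _ _ => ContDiffAt.sum fun _ _ =>
    (contDiffAt_gram_inv hf hdet _ _).mul ((contDiffAt_dirD hN _).inner ℝ (contDiffAt_dirD hf _))

/-- At a point where the coordinate frame is orthonormal, the derivative of the inverse metric is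
minus the derivative of the metric. -/
lemma dirD_gram_inv {f : E → V} (hf : ContDiffAt ℝ 2 f x₀)
    (h1 : Matrix.gram ℝ (dirD b f x₀) = 1) (i j k : ι) :
    dirD b (fun y => (Matrix.gram ℝ (dirD b f y))⁻¹ i j) x₀ k =
      -(⟪dirD b f x₀ i, dirD b (fun y => dirD b f y j) x₀ k⟫
        + ⟪dirD b (fun y => dirD b f y i) x₀ k, dirD b f x₀ j⟫) := by
  have hdet : (Matrix.gram ℝ (dirD b f x₀)).det ≠ 0 := by simp [h1]
  have hdf : ∀ i, DifferentiableAt ℝ (fun y => dirD b f y i) x₀ := fun i =>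
    (contDiffAt_dirD (m := 1) hf i).differentiableAt one_ne_zero
  have hG : ∀ i j, DifferentiableAt ℝ (fun y => (Matrix.gram ℝ (dirD b f y))⁻¹ i j) x₀ :=
    fun i j => (contDiffAt_gram_inv (m := 1) hf hdet i j).differentiableAt one_ne_zero
  have hg : ∀ i j, DifferentiableAt ℝ (fun y => ⟪dirD b f y i, dirD b f y j⟫) x₀ :=
    fun i j => (hdf i).inner ℝ (hdf j)
  -- Differentiate `G⁻¹ G = 1`, which holds near `x₀` since nondegeneracy is an open condition.
  have hev : (fun y => ∑ l, (Matrix.gram ℝ (dirD b f y))⁻¹ i l * ⟪dirD b f y l, dirD b f y j⟫)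
      =ᶠ[𝓝 x₀] fun _ => (1 : Matrix ι ι ℝ) i j := by
    filter_upwards [eventually_gram_det_ne_zero (hf.of_le (by norm_num)) hdet] with y hy
    have := Matrix.nonsing_inv_mul (Matrix.gram ℝ (dirD b f y)) (isUnit_iff_ne_zero.mpr hy)
    exact congrFun (congrFun this i) j
  have h := congrFun (dirD_congr (b := b) hev) k
  rw [dirD_const, dirD_sum (fun l _ => (hG i l).fun_mul (hg l j))] at h
  simp only [dirD_mul (hG _ _) (hg _ _), dirD_inner (hdf _) (hdf _)] at h
  have ho : ∀ l, ⟪dirD b f x₀ l, dirD b f x₀ j⟫ = (1 : Matrix ι ι ℝ) l j :=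
    fun l => congrFun (congrFun h1 l) j
  simp only [h1, inv_one, ho, Finset.sum_add_distrib, Matrix.one_apply, ite_mul, mul_ite, one_mul,
    zero_mul, mul_one, mul_zero, Finset.sum_ite_eq, Finset.sum_ite_eq', Finset.mem_univ, if_true,
    Pi.zero_apply] at h
  linarith

lemma dirD_frameDiv {f N : E → V} (hf : ContDiffAt ℝ 2 f x₀) (hN : ContDiffAt ℝ 2 N x₀)
    (h1 : Matrix.gram ℝ (dirD b f x₀) = 1) (k : ι) :
    dirD b (fun y => frameDiv (dirD b f y) (dirD b N y)) x₀ k =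
      ∑ i, (⟪dirD b N x₀ i, dirD b (fun y => dirD b f y i) x₀ k⟫
          + ⟪dirD b (fun y => dirD b N y i) x₀ k, dirD b f x₀ i⟫)
        - ∑ i, ∑ j, (⟪dirD b f x₀ i, dirD b (fun y => dirD b f y j) x₀ k⟫
          + ⟪dirD b (fun y => dirD b f y i) x₀ k, dirD b f x₀ j⟫)
            * ⟪dirD b N x₀ i, dirD b f x₀ j⟫ := by
  have hdet : (Matrix.gram ℝ (dirD b f x₀)).det ≠ 0 := by simp [h1]
  have hdf : ∀ i, DifferentiableAt ℝ (fun y => dirD b f y i) x₀ := fun i =>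
    (contDiffAt_dirD (m := 1) hf i).differentiableAt one_ne_zero
  have hdN : ∀ i, DifferentiableAt ℝ (fun y => dirD b N y i) x₀ := fun i =>
    (contDiffAt_dirD (m := 1) hN i).differentiableAt one_ne_zero
  have hG : ∀ i j, DifferentiableAt ℝ (fun y => (Matrix.gram ℝ (dirD b f y))⁻¹ i j) x₀ :=
    fun i j => (contDiffAt_gram_inv (m := 1) hf hdet i j).differentiableAt one_ne_zero
  have hg : ∀ i j, DifferentiableAt ℝ (fun y => ⟪dirD b N y i, dirD b f y j⟫) x₀ :=
    fun i j => (hdN i).inner ℝ (hdf j)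
  simp only [frameDiv]
  rw [dirD_sum fun i _ => DifferentiableAt.fun_sum fun j _ => (hG i j).fun_mul (hg i j),
    ← Finset.sum_sub_distrib]
  refine Finset.sum_congr rfl fun i _ => ?_
  rw [dirD_sum fun j _ => (hG i j).fun_mul (hg i j)]
  simp only [dirD_mul (hG _ _) (hg _ _), dirD_inner (hdN _) (hdf _), dirD_gram_inv hf h1]
  simp only [h1, inv_one, Finset.sum_add_distrib, Matrix.one_apply, ite_mul, one_mul,
    zero_mul, Finset.sum_ite_eq, Finset.mem_univ, if_true, neg_mul, Finset.sum_neg_distrib]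
  ring

/-- The linearized soliton operator annihilates `⟪T f, N⟫` for a parametrized self-expander `f`
with unit normal `N`, at a point where the frame `∂_b f` is orthonormal. -/
theorem local_soliton {f N : E → V} {C lam : ℝ} (T : V →L[ℝ] V)
    (hT : ∀ y, ⟪T y, y⟫ = lam * ⟪y, y⟫)
    (hf : ContDiffAt ℝ 3 f x₀) (hN : ContDiffAt ℝ 3 N x₀)
    (h1 : Matrix.gram ℝ (dirD b f x₀) = 1)
    (hexp : ∀ y : V, y = ∑ k, ⟪y, dirD b f x₀ k⟫ • dirD b f x₀ k + ⟪y, N x₀⟫ • N x₀)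
    (hperp : ∀ᶠ y in 𝓝 x₀, ∀ i, ⟪dirD b f y i, N y⟫ = 0)
    (hunit : ∀ᶠ y in 𝓝 x₀, ‖N y‖ = 1)
    (hsol : ∀ᶠ y in 𝓝 x₀, C * (-frameDiv (dirD b f y) (dirD b N y)) * ⟪f y, N y⟫ = -1) :
    frameDiv (dirD b f x₀)
        (dirD b (fun y => frameGrad (dirD b f y) (dirD b (fun z => ⟪T (f z), N z⟫) y)) x₀)
      + C * (-frameDiv (dirD b f x₀) (dirD b N x₀)) ^ 2
        * ⟪f x₀, frameGrad (dirD b f x₀) (dirD b (fun z => ⟪T (f z), N z⟫) x₀)⟫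
      + (frameNormSq (dirD b f x₀) (dirD b N x₀)
          - C * (-frameDiv (dirD b f x₀) (dirD b N x₀)) ^ 2) * ⟪T (f x₀), N x₀⟫ = 0 := by
  have hdet : (Matrix.gram ℝ (dirD b f x₀)).det ≠ 0 := by simp [h1]
  -- `ContDiffAt` spreads to a neighbourhood because the order 3 is finite.
  have hfE := hf.eventually (by simp)
  have hNE := hN.eventually (by simp)
  have hf2 : ContDiffAt ℝ 2 f x₀ := hf.of_le (by norm_num)
  have hN2 : ContDiffAt ℝ 2 N x₀ := hN.of_le (by norm_num)
  have hTf : ∀ {y}, ContDiffAt ℝ 3 f y → ContDiffAt ℝ 3 (fun z => T (f z)) y := fun h =>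
    T.contDiff.contDiffAt.comp _ h
  have hd : ∀ {X : E → V} {y}, ContDiffAt ℝ 3 X y → DifferentiableAt ℝ X y := fun h =>
    h.differentiableAt (by norm_num)
  have hdd : ∀ {X : E → V} {y}, ContDiffAt ℝ 3 X y → ∀ i,
      DifferentiableAt ℝ (fun y => dirD b X y i) y := fun h i =>
    (contDiffAt_dirD (m := 2) h i).differentiableAt (by norm_num)
  set a := dirD b f x₀ with ha_def
  set N1 := dirD b N x₀ with hN1_def
  set A2 : ι → ι → V := fun i => dirD b (fun y => dirD b f y i) x₀ with hA2_def
  set N2 : ι → ι → V := fun i => dirD b (fun y => dirD b N y i) x₀ with hN2_def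
  have hA2s : ∀ i j, A2 i j = A2 j i := fun i j => dirD_comm hf2 i j
  have hN2s : ∀ i j, N2 i j = N2 j i := fun i j => dirD_comm hN2 i j
  have hν : ⟪N x₀, N x₀⟫ = (1 : ℝ) := by
    rw [real_inner_self_eq_norm_sq, hunit.self_of_nhds]; norm_num
  -- the normal derivative of the unit normal vanishes
  have hN1E : ∀ᶠ y in 𝓝 x₀, ∀ i, ⟪dirD b N y i, N y⟫ = 0 := by
    filter_upwards [hunit.eventually_nhds, hNE] with y hy hNy i
    have : (fun z => ⟪N z, N z⟫) =ᶠ[𝓝 y] fun _ => (1 : ℝ) := by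
      filter_upwards [hy] with z hz
      rw [real_inner_self_eq_norm_sq, hz]; norm_num
    have h := congrFun (dirD_congr (b := b) this) i
    rw [dirD_const, dirD_inner (hd hNy) (hd hNy), real_inner_comm] at h
    simp only [Pi.zero_apply] at h
    linarith
  have hA2E : ∀ᶠ y in 𝓝 x₀, ∀ i j,
      ⟪dirD b (fun z => dirD b f z i) y j, N y⟫ = -⟪dirD b N y j, dirD b f y i⟫ := by
    filter_upwards [hperp.eventually_nhds, hNE, hfE] with y hy hNy hfy i j
    have : (fun z => ⟪dirD b f z i, N z⟫) =ᶠ[𝓝 y] fun _ => (0 : ℝ) := by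
      filter_upwards [hy] with z hz using hz i
    have h := congrFun (dirD_congr (b := b) this) j
    rw [dirD_const, dirD_inner (hdd hfy i) (hd hNy), real_inner_comm] at h
    simp only [Pi.zero_apply] at h
    linarith
  have hsymmE : ∀ᶠ y in 𝓝 x₀, ∀ i j,
      ⟪dirD b N y i, dirD b f y j⟫ = ⟪dirD b N y j, dirD b f y i⟫ := by
    filter_upwards [hA2E, hfE] with y hy hfy i j
    have e1 := hy j i
    rw [dirD_comm (hfy.of_le (by norm_num)), hy i j] at e1
    linarith
  have hN2ν : ∀ i j, ⟪N2 i j, N x₀⟫ = -⟪N1 i, N1 j⟫ := by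
    intro i j
    have : (fun z => ⟪dirD b N z i, N z⟫) =ᶠ[𝓝 x₀] fun _ => (0 : ℝ) := by
      filter_upwards [hN1E] with z hz using hz i
    have h := congrFun (dirD_congr (b := b) this) j
    rw [dirD_const, dirD_inner (hdd hN i) (hd hN)] at h
    simp only [Pi.zero_apply] at h
    linarith
  -- Codazzi in flat ambient space: differentiate the symmetry of the second fundamental form, which
  -- holds on a neighbourhood.
  have hcod : ∀ i j k, ⟪N1 i, A2 j k⟫ + ⟪N2 i k, a j⟫ = ⟪N1 j, A2 i k⟫ + ⟪N2 j k, a i⟫ := by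
    intro i j k
    have : (fun z => ⟪dirD b N z i, dirD b f z j⟫) =ᶠ[𝓝 x₀]
        fun z => ⟪dirD b N z j, dirD b f z i⟫ := by
      filter_upwards [hsymmE] with z hz using hz i j
    have h := congrFun (dirD_congr (b := b) this) k
    rwa [dirD_inner (hdd hN i) (hdd hf j), dirD_inner (hdd hN j) (hdd hf i)] at h
  have hN1x : ∀ i, ⟪N1 i, N x₀⟫ = 0 := hN1E.self_of_nhds
  have hsymm : ∀ i j, ⟪N1 i, a j⟫ = ⟪N1 j, a i⟫ := hsymmE.self_of_nhds
  -- the derivative of the mean curvature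
  set H : E → ℝ := fun y => -frameDiv (dirD b f y) (dirD b N y) with hH_def
  have hHd : DifferentiableAt ℝ H x₀ :=
    ((contDiffAt_frameDiv (m := 1) hf2 hN2 hdet).differentiableAt one_ne_zero).neg
  have hdH : ∀ k, dirD b H x₀ k = ∑ i, (-⟪N2 i k, a i⟫ + ⟪N1 i, A2 i k⟫) := by
    intro k
    have hpar : ∀ i, ∑ j, ⟪a j, A2 i k⟫ * ⟪N1 i, a j⟫ = ⟪N1 i, A2 i k⟫ := by
      intro i
      conv_rhs => rw [hexp (N1 i), hN1x]
      simp only [zero_smul, add_zero, sum_inner, real_inner_smul_left, mul_comm]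
    have hpar1 : ∑ i, ∑ j, ⟪A2 i k, a j⟫ * ⟪N1 i, a j⟫ = ∑ i, ⟪N1 i, A2 i k⟫ := by
      refine Finset.sum_congr rfl fun i _ => ?_
      rw [← hpar]
      exact Finset.sum_congr rfl fun j _ => by rw [real_inner_comm]
    have hpar2 : ∑ i, ∑ j, ⟪a i, A2 j k⟫ * ⟪N1 i, a j⟫ = ∑ i, ⟪N1 i, A2 i k⟫ := by
      rw [Finset.sum_comm]
      refine Finset.sum_congr rfl fun i _ => ?_
      rw [← hpar]
      exact Finset.sum_congr rfl fun j _ => by rw [hsymm]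
    -- The derivative of the inverse metric contributes the sum of `⟪N1 i, A2 i k⟫` twice, reversing
    -- the sign of the one from the product rule.
    rw [dirD_neg, dirD_frameDiv hf2 hN2 h1]
    change -(∑ i, (⟪N1 i, A2 i k⟫ + ⟪N2 i k, a i⟫)
      - ∑ i, ∑ j, (⟪a i, A2 j k⟫ + ⟪A2 i k, a j⟫) * ⟪N1 i, a j⟫) = _
    simp only [add_mul, Finset.sum_add_distrib, hpar1, hpar2, Finset.sum_neg_distrib]
    ring
  have hdsol : ∀ k, dirD b H x₀ k = C * H x₀ ^ 2 * ⟪f x₀, N1 k⟫ := by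
    intro k
    have hu := (hd hf).inner ℝ (hd hN)
    have hev : (fun y => H y * ⟪f y, N y⟫ * C) =ᶠ[𝓝 x₀] fun _ => (-1 : ℝ) := by
      filter_upwards [hsol] with y hy
      rw [← hy]; ring
    have h := congrFun (dirD_congr (b := b) hev) k
    rw [dirD_const, dirD_mul (hHd.fun_mul hu) (differentiableAt_const _), dirD_mul hHd hu,
      dirD_const, dirD_inner (hd hf) (hd hN), hperp.self_of_nhds k] at h
    simp only [Pi.zero_apply] at h
    have hs : C * H x₀ * ⟪f x₀, N x₀⟫ = -1 := hsol.self_of_nhds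
    -- Multiplying the differentiated equation by `H` lets the equation itself replace `C * H * ⟪f,
    -- N⟫` by `-1`, so no division is needed.
    linear_combination dirD b H x₀ k * hs - H x₀ * h
  -- the derivatives of the function
  set φ : E → ℝ := fun z => ⟪T (f z), N z⟫ with hφ_def
  have hφE : ∀ᶠ y in 𝓝 x₀, ∀ i,
      dirD b φ y i = ⟪T (f y), dirD b N y i⟫ + ⟪T (dirD b f y i), N y⟫ := by
    filter_upwards [hfE, hNE] with y hfy hNy i
    rw [dirD_inner (hd (hTf hfy)) (hd hNy), dirD_clm T (hd hfy)]
  have hφc : ContDiffAt ℝ 3 φ x₀ := (hTf hf).inner ℝ hN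
  have hφ2 : ∀ i j, dirD b (fun y => dirD b φ y i) x₀ j =
      ⟪T (f x₀), N2 i j⟫ + ⟪T (a j), N1 i⟫ + (⟪T (a i), N1 j⟫ + ⟪T (A2 i j), N x₀⟫) := by
    intro i j
    have hev : (fun y => dirD b φ y i) =ᶠ[𝓝 x₀]
        fun y => ⟪T (f y), dirD b N y i⟫ + ⟪T (dirD b f y i), N y⟫ := by
      filter_upwards [hφE] with y hy using hy i
    have hTd : DifferentiableAt ℝ (fun y => T (dirD b f y i)) x₀ :=
      T.differentiableAt.comp x₀ (hdd hf i)
    rw [dirD_congr hev, dirD_add ((hd (hTf hf)).inner ℝ (hdd hN i)) (hTd.inner ℝ (hd hN)),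
      dirD_inner (hd (hTf hf)) (hdd hN i), dirD_inner hTd (hd hN), dirD_clm T (hd hf),
      dirD_clm T (hdd hf i)]
  -- the gradient
  set X : E → V := fun y => frameGrad (dirD b f y) (dirD b φ y) with hX_def
  have hXd : DifferentiableAt ℝ X x₀ :=
    (contDiffAt_frameGrad (m := 2) hf hdet fun i => contDiffAt_dirD hφc i).differentiableAt
      (by norm_num)
  have hX0 : X x₀ = ∑ k, dirD b φ x₀ k • a k := frameGrad_of_gram_eq_one h1 _
  have hX1 : ∀ i, ⟪dirD b X x₀ i, a i⟫ =
      dirD b (fun y => dirD b φ y i) x₀ i - ⟪X x₀, A2 i i⟫ := by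
    intro i
    have hev : (fun y => ⟪X y, dirD b f y i⟫) =ᶠ[𝓝 x₀] fun y => dirD b φ y i := by
      filter_upwards [eventually_gram_det_ne_zero (hf.of_le (by norm_num)) hdet] with y hy
      exact inner_frameGrad (isUnit_iff_ne_zero.mpr hy) _ _
    have h := congrFun (dirD_congr (b := b) hev) i
    rw [dirD_inner hXd (hdd hf i)] at h
    rw [← h]
    simp only [A2]
    ring
  have hφ1 : ∀ k, dirD b φ x₀ k = ⟪T (a k), N x₀⟫ + ⟪T (f x₀), N1 k⟫ := fun k => by
    rw [hφE.self_of_nhds k, add_comm]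
  have main := soliton_identity (a := a) (N1 := N1) (A2 := A2) (N2 := N2) (ν := N x₀)
    (x := f x₀) (C := C) (H := H x₀) (dH := dirD b H x₀) T hT h1 hν hexp hN1x
    (fun i j => by rw [hsymm]; exact hA2E.self_of_nhds i j) hsymm (fun i => hN2ν i i)
    (fun i k => by
      have e := hcod i k i
      rw [hA2s k i, hN2s k i] at e
      linarith)
    (by simp only [hH_def]; rw [← frameDiv_of_gram_eq_one h1]) hdH hsol.self_of_nhds hdsol
  rw [frameDiv_of_gram_eq_one h1, frameNormSq_of_gram_eq_one h1]
  change ∑ i, ⟪dirD b X x₀ i, a i⟫ + C * H x₀ ^ 2 * ⟪f x₀, X x₀⟫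
    + (∑ i, ∑ j, ⟪N1 i, a j⟫ ^ 2 - C * H x₀ ^ 2) * ⟪T (f x₀), N x₀⟫ = 0
  rw [← main]
  simp only [hX1, hφ2, hX0, hφ1, sum_inner, inner_sum, real_inner_smul_left,
    real_inner_smul_right]
  congr 2
  refine Finset.sum_congr rfl fun i _ => ?_
  ring

end Local

/-! ### Codimension one: the frame and its normal span, and smoothness of the normal -/

section UnitNormal

open Filter Topology Module

variable {ι E V : Type*} [Fintype ι] [NormedAddCommGroup E] [NormedSpace ℝ E]
  [NormedAddCommGroup V] [InnerProductSpace ℝ V] [FiniteDimensional ℝ V]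

lemma eq_zero_of_inner_frame_normal (hV : finrank ℝ V = Fintype.card ι + 1) {a : ι → V}
    (ha : LinearIndependent ℝ a) {ν x : V} (hν : ‖ν‖ = 1) (hνa : ∀ i, ⟪a i, ν⟫ = 0)
    (hxa : ∀ i, ⟪a i, x⟫ = 0) (hxν : ⟪x, ν⟫ = 0) : x = 0 := by
  set S : Submodule ℝ V := Submodule.span ℝ (Set.range a) with hS
  have hmem : ∀ z : V, (∀ i, ⟪a i, z⟫ = 0) → z ∈ Sᗮ := by
    intro z hz
    rw [Submodule.mem_orthogonal]
    intro u hu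
    induction hu using Submodule.span_induction with
    | mem u hu => obtain ⟨i, rfl⟩ := hu; exact hz i
    | zero => exact inner_zero_left _
    | add u v _ _ hu hv => rw [inner_add_left, hu, hv, add_zero]
    | smul c u _ hu => rw [real_inner_smul_left, hu, mul_zero]
  have hfr : finrank ℝ Sᗮ = 1 := by
    have h := S.finrank_add_finrank_orthogonal
    rw [hS, finrank_span_eq_card ha, ← hS, hV] at h
    omega
  have hν0 : (⟨ν, hmem ν hνa⟩ : Sᗮ) ≠ 0 := by
    intro h
    have : ν = 0 := congrArg Subtype.val h
    simp [this] at hν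
  obtain ⟨c, hc⟩ := (finrank_eq_one_iff_of_nonzero' _ hν0).mp hfr ⟨x, hmem x hxa⟩
  have hcx : c • ν = x := congrArg Subtype.val hc
  rw [← hcx, real_inner_smul_left, real_inner_self_eq_norm_sq, hν] at hxν
  have : c = 0 := by simpa using hxν
  rw [← hcx, this, zero_smul]

variable [DecidableEq ι]

lemma eq_sum_frame_normal (hV : finrank ℝ V = Fintype.card ι + 1) {a : ι → V}
    (ha : Matrix.gram ℝ a = 1) {ν : V} (hν : ‖ν‖ = 1) (hνa : ∀ i, ⟪a i, ν⟫ = 0) (y : V) :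
    y = ∑ k, ⟪y, a k⟫ • a k + ⟪y, ν⟫ • ν := by
  have ho := Matrix.gram_eq_one_iff_orthonormal.mp ha
  have hνν : ⟪ν, ν⟫ = (1 : ℝ) := by rw [real_inner_self_eq_norm_sq, hν]; norm_num
  rw [← sub_eq_zero]
  refine eq_zero_of_inner_frame_normal hV ho.linearIndependent hν hνa (fun i => ?_) ?_
  · rw [inner_sub_right, inner_add_right, ho.inner_right_fintype, real_inner_smul_right, hνa,
      real_inner_comm]
    simp
  · simp only [inner_sub_left, inner_add_left, sum_inner, real_inner_smul_left, hνa, hνν]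
    simp

/-- A continuous unit normal field along an immersed hypersurface is as smooth as its tangent
spaces. -/
lemma contDiffAt_unitNormal {b : ι → E} {x₀ : E} {m : ℕ∞ω} {f N : E → V}
    (hV : finrank ℝ V = Fintype.card ι + 1) (hf : ContDiffAt ℝ (m + 1) f x₀)
    (hdet : (Matrix.gram ℝ (dirD b f x₀)).det ≠ 0) (hN : ContinuousAt N x₀)
    (hperp : ∀ᶠ y in 𝓝 x₀, ∀ i, ⟪dirD b f y i, N y⟫ = 0) (hunit : ∀ᶠ y in 𝓝 x₀, ‖N y‖ = 1) :
    ContDiffAt ℝ m N x₀ := by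
  set w := N x₀ with hw
  have hww : ⟪w, w⟫ = (1 : ℝ) := by
    rw [real_inner_self_eq_norm_sq, hunit.self_of_nhds]; norm_num
  -- The projection of the fixed vector `w = N x₀` to the moving normal line is as smooth as the
  -- tangent frame; normalizing it recovers `N` up to sign.
  set P : E → V := fun y => w - frameGrad (dirD b f y) (fun i => ⟪w, dirD b f y i⟫) with hP
  have hPc : ContDiffAt ℝ m P x₀ := contDiffAt_const.sub
    (contDiffAt_frameGrad hf hdet fun i => contDiffAt_const.inner ℝ (contDiffAt_dirD hf i))
  have hPN : ∀ᶠ y in 𝓝 x₀, P y = ⟪w, N y⟫ • N y := by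
    filter_upwards [eventually_gram_det_ne_zero (hf.of_le le_add_self) hdet, hperp, hunit]
      with y hy hp hu
    have hNN : ⟪N y, N y⟫ = (1 : ℝ) := by rw [real_inner_self_eq_norm_sq, hu]; norm_num
    have hgN : ⟪frameGrad (dirD b f y) (fun i => ⟪w, dirD b f y i⟫), N y⟫ = 0 := by
      rw [frameGrad_eq, sum_inner]
      exact Finset.sum_eq_zero fun i _ => by rw [real_inner_smul_left, hp, mul_zero]
    rw [← sub_eq_zero]
    refine eq_zero_of_inner_frame_normal hV (Matrix.linearIndependent_of_det_gram_ne_zero hy)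
      hu hp (fun i => ?_) ?_
    · rw [inner_sub_right, real_inner_smul_right, hp, inner_sub_right, real_inner_comm (frameGrad _ _),
        inner_frameGrad (isUnit_iff_ne_zero.mpr hy), real_inner_comm w]
      simp
    · simp only [hP, inner_sub_left, hgN, real_inner_smul_left, hNN]
      simp
  -- Continuity of `N` is used exactly here, to fix the sign.
  have hpos : ∀ᶠ y in 𝓝 x₀, 0 < ⟪w, N y⟫ := by
    have hc : ContinuousAt (fun y => ⟪w, N y⟫) x₀ := continuousAt_const.inner hN
    exact hc.eventually (lt_mem_nhds (hww ▸ one_pos : (0 : ℝ) < ⟪w, w⟫))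
  have hP0 : P x₀ ≠ 0 := by
    rw [hPN.self_of_nhds, ← hw, hww, one_smul]
    intro h
    simp [h] at hww
  have hq : ContDiffAt ℝ m (fun y => ‖P y‖⁻¹ • P y) x₀ :=
    ((hPc.norm ℝ hP0).inv (norm_ne_zero_iff.mpr hP0)).smul hPc
  refine hq.congr_of_eventuallyEq ?_
  filter_upwards [hPN, hpos, hunit] with y h1 h2 h3
  rw [h1, norm_smul, h3, mul_one, Real.norm_of_nonneg h2.le, smul_smul, inv_mul_cancel₀ h2.ne',
    one_smul]

end UnitNormal

/-! ### From the manifold to one fixed chart -/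

section Chart

open Filter Topology Module

variable {n : ℕ} {M : Type*} [TopologicalSpace M] [ChartedSpace (EuclideanSpace ℝ (Fin n)) M]

/-- The expression of a function on `M` in the preferred chart at `p`. -/
def inChart {W : Type*} (p : M) (X : M → W) (y : EuclideanSpace ℝ (Fin n)) : W :=
  X ((extChartAt (𝓡 n) p).symm y)

lemma inChart_apply {W : Type*} {p q : M} (X : M → W)
    (hq : q ∈ (chartAt (EuclideanSpace ℝ (Fin n)) p).source) :
    inChart p X (extChartAt (𝓡 n) p q) = X q := by
  rw [inChart, (extChartAt (𝓡 n) p).left_inv (by simpa using hq)]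

variable {W : Type*} [NormedAddCommGroup W] [NormedSpace ℝ W] {p q : M}

lemma eventually_nhds_extChartAt {P : EuclideanSpace ℝ (Fin n) → Prop}
    (h : ∀ q ∈ (chartAt (EuclideanSpace ℝ (Fin n)) p).source, P (extChartAt (𝓡 n) p q)) :
    ∀ᶠ y in 𝓝 (extChartAt (𝓡 n) p p), P y := by
  filter_upwards [extChartAt_target_mem_nhds (I := 𝓡 n) p] with y hy
  have hs := (extChartAt (𝓡 n) p).map_target hy
  rw [extChartAt_source] at hs
  have := h _ hs
  rwa [(extChartAt (𝓡 n) p).right_inv hy] at this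

lemma contMDiffAt_iff_inChart {m : ℕ∞ω} [IsManifold (𝓡 n) m M] {X : M → W}
    (hq : q ∈ (chartAt (EuclideanSpace ℝ (Fin n)) p).source) :
    ContMDiffAt (𝓡 n) 𝓘(ℝ, W) m X q ↔ ContDiffAt ℝ m (inChart p X) (extChartAt (𝓡 n) p q) := by
  rw [contMDiffAt_iff_source_of_mem_source hq, ModelWithCorners.range_eq_univ,
    contMDiffWithinAt_univ, contMDiffAt_iff_contDiffAt]
  rfl

/-- The derivative of the preferred chart at `p`. -/
def chartD (p q : M) : EuclideanSpace ℝ (Fin n) →L[ℝ] EuclideanSpace ℝ (Fin n) :=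
  mfderiv (𝓡 n) 𝓘(ℝ, EuclideanSpace ℝ (Fin n)) (extChartAt (𝓡 n) p) q

variable [IsManifold (𝓡 n) ∞ M]

lemma chartD_isInvertible (hq : q ∈ (chartAt (EuclideanSpace ℝ (Fin n)) p).source) :
    (chartD (n := n) p q).IsInvertible := by
  have : IsManifold (𝓡 n) 1 M := IsManifold.of_le (m := 1) (n := ∞) (by simp)
  exact isInvertible_mfderiv_extChartAt (by simpa using hq)

lemma mfderiv_apply_inChart (hq : q ∈ (chartAt (EuclideanSpace ℝ (Fin n)) p).source)
    {X : M → W} (hX : DifferentiableAt ℝ (inChart p X) (extChartAt (𝓡 n) p q))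
    (v : EuclideanSpace ℝ (Fin n)) :
    mfderiv (𝓡 n) 𝓘(ℝ, W) X q v =
      fderiv ℝ (inChart p X) (extChartAt (𝓡 n) p q) (chartD p q v) := by
  have : IsManifold (𝓡 n) 1 M := IsManifold.of_le (m := 1) (n := ∞) (by simp)
  have hev : X =ᶠ[𝓝 q] inChart p X ∘ extChartAt (𝓡 n) p := by
    filter_upwards [(chartAt (EuclideanSpace ℝ (Fin n)) p).open_source.mem_nhds hq] with z hz
    exact (inChart_apply X hz).symm
  have h := mfderiv_comp_apply q hX.mdifferentiableAt
    (mdifferentiableAt_extChartAt (I := 𝓡 n) hq) v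
  rw [mfderiv_eq_fderiv] at h
  rw [hev.mfderiv_eq]
  exact h

/-- The matrix of the derivative of the preferred chart at `p`, with respect to the standard basis
and the basis `b`. -/
def chartMatrix (b : Basis (Fin n) ℝ (EuclideanSpace ℝ (Fin n))) (p q : M) :
    Matrix (Fin n) (Fin n) ℝ :=
  LinearMap.toMatrix (EuclideanSpace.basisFun (Fin n) ℝ).toBasis b (chartD p q).toLinearMap

variable (b : Basis (Fin n) ℝ (EuclideanSpace ℝ (Fin n)))

lemma isUnit_det_chartMatrix (hq : q ∈ (chartAt (EuclideanSpace ℝ (Fin n)) p).source) :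
    IsUnit (chartMatrix b p q).det := by
  obtain ⟨A, hA⟩ := chartD_isInvertible (n := n) hq
  have h := LinearEquiv.isUnit_det A.toLinearEquiv (EuclideanSpace.basisFun (Fin n) ℝ).toBasis b
  rw [chartMatrix, ← hA]
  exact h

/-- The basis used by `partialD` at `q` comes from the preferred chart at `q` and may jump as `q`
varies, so it cannot be differentiated. This passes to the frame of the one chart at `p`, in a
constant basis `b` still free to be chosen. -/
lemma partialD_eq_reframe (hq : q ∈ (chartAt (EuclideanSpace ℝ (Fin n)) p).source)
    {X : M → W} (hX : DifferentiableAt ℝ (inChart p X) (extChartAt (𝓡 n) p q)) :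
    partialD X q =
      reframe (chartMatrix b p q) (dirD b (inChart p X) (extChartAt (𝓡 n) p q)) := by
  funext i
  rw [partialD, mfderiv_apply_inChart hq hX, reframe]
  simp only [dirD, ← map_smul, ← map_sum]
  congr 1
  simp only [chartMatrix, LinearMap.toMatrix_apply]
  rw [b.sum_repr]
  simp

variable {F ν : M → Ambient n}

lemma surfaceDiv_eq_frameDiv (hq : q ∈ (chartAt (EuclideanSpace ℝ (Fin n)) p).source)
    {X : M → Ambient n} (hF : DifferentiableAt ℝ (inChart p F) (extChartAt (𝓡 n) p q))
    (hX : DifferentiableAt ℝ (inChart p X) (extChartAt (𝓡 n) p q)) :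
    surfaceDiv F X q = frameDiv (dirD b (inChart p F) (extChartAt (𝓡 n) p q))
      (dirD b (inChart p X) (extChartAt (𝓡 n) p q)) := by
  change frameDiv (partialD F q) (partialD X q) = _
  rw [partialD_eq_reframe b hq hF, partialD_eq_reframe b hq hX,
    frameDiv_reframe (isUnit_det_chartMatrix b hq)]

lemma surfaceGrad_eq_frameGrad (hq : q ∈ (chartAt (EuclideanSpace ℝ (Fin n)) p).source)
    {φ : M → ℝ} (hF : DifferentiableAt ℝ (inChart p F) (extChartAt (𝓡 n) p q))
    (hφ : DifferentiableAt ℝ (inChart p φ) (extChartAt (𝓡 n) p q)) :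
    surfaceGrad F φ q = frameGrad (dirD b (inChart p F) (extChartAt (𝓡 n) p q))
      (dirD b (inChart p φ) (extChartAt (𝓡 n) p q)) := by
  change frameGrad (partialD F q) (partialD φ q) = _
  rw [partialD_eq_reframe b hq hF, partialD_eq_reframe b hq hφ,
    frameGrad_reframe (isUnit_det_chartMatrix b hq)]

lemma normSqA_eq_frameNormSq (hq : q ∈ (chartAt (EuclideanSpace ℝ (Fin n)) p).source)
    (hF : DifferentiableAt ℝ (inChart p F) (extChartAt (𝓡 n) p q))
    (hν : DifferentiableAt ℝ (inChart p ν) (extChartAt (𝓡 n) p q)) :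
    normSqA F ν q = frameNormSq (dirD b (inChart p F) (extChartAt (𝓡 n) p q))
      (dirD b (inChart p ν) (extChartAt (𝓡 n) p q)) := by
  change frameNormSq (partialD F q) (partialD ν q) = _
  rw [partialD_eq_reframe b hq hF, partialD_eq_reframe b hq hν,
    frameNormSq_reframe (isUnit_det_chartMatrix b hq)]

lemma injective_fderiv_inChart (hF : IsSmoothImmersion F)
    (hq : q ∈ (chartAt (EuclideanSpace ℝ (Fin n)) p).source) :
    Function.Injective (fderiv ℝ (inChart p F) (extChartAt (𝓡 n) p q)) := by
  have hd : DifferentiableAt ℝ (inChart p F) (extChartAt (𝓡 n) p q) :=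
    ((contMDiffAt_iff_inChart hq).mp (hF.1 q)).differentiableAt (by simp)
  obtain ⟨A, hA⟩ := chartD_isInvertible (n := n) hq
  intro v w hvw
  have key : ∀ u, fderiv ℝ (inChart p F) (extChartAt (𝓡 n) p q) u =
      mfderiv (𝓡 n) 𝓘(ℝ, Ambient n) F q (A.symm u) := by
    intro u
    rw [mfderiv_apply_inChart hq hd, ← hA]
    simp
  rw [key, key] at hvw
  exact A.symm.injective (hF.2 q hvw)

lemma inner_fderiv_inChart (hF : IsSmoothImmersion F) (hν : IsUnitNormal F ν)
    (hq : q ∈ (chartAt (EuclideanSpace ℝ (Fin n)) p).source) (v : EuclideanSpace ℝ (Fin n)) :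
    ⟪fderiv ℝ (inChart p F) (extChartAt (𝓡 n) p q) v, ν q⟫ = 0 := by
  have hd : DifferentiableAt ℝ (inChart p F) (extChartAt (𝓡 n) p q) :=
    ((contMDiffAt_iff_inChart hq).mp (hF.1 q)).differentiableAt (by simp)
  obtain ⟨A, hA⟩ := chartD_isInvertible (n := n) hq
  have h := hν.2.2 q (A.symm v)
  rw [mfderiv_apply_inChart hq hd, ← hA] at h
  simpa using h

/-- An injective linear map to an inner product space maps some basis to an orthonormal family. -/
lemma exists_basis_gram_eq_one {E V : Type*} [NormedAddCommGroup E] [NormedSpace ℝ E]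
    [FiniteDimensional ℝ E] (hE : finrank ℝ E = n) [NormedAddCommGroup V] [InnerProductSpace ℝ V]
    (A : E →ₗ[ℝ] V) (hA : Function.Injective A) :
    ∃ b : Basis (Fin n) ℝ E, Matrix.gram ℝ (fun i => A (b i)) = 1 := by
  let e := LinearEquiv.ofInjective A hA
  have hr : finrank ℝ (LinearMap.range A) = n := by rw [← e.finrank_eq, hE]
  let o := (stdOrthonormalBasis ℝ (LinearMap.range A)).reindex (finCongr hr)
  refine ⟨o.toBasis.map e.symm, ?_⟩
  rw [Matrix.gram_eq_one_iff_orthonormal]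
  have : (fun i => A ((o.toBasis.map e.symm) i)) = (LinearMap.range A).subtypeₗᵢ ∘ o := by
    funext i
    simp [e]
  rw [this]
  exact o.orthonormal.comp_linearIsometry _

end Chart

/-! ### Kernel elements of the linearized operator -/

section Kernel

open Filter Topology Module

variable {n : ℕ} {M : Type*} [TopologicalSpace M] [ChartedSpace (EuclideanSpace ℝ (Fin n)) M]
  [IsManifold (𝓡 n) ∞ M] {F ν : M → Ambient n} {C : ℝ}

lemma IsSmoothImmersion.contDiffAt_inChart (hF : IsSmoothImmersion F) {p q : M}
    (hq : q ∈ (chartAt (EuclideanSpace ℝ (Fin n)) p).source) :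
    ContDiffAt ℝ ∞ (inChart p F) (extChartAt (𝓡 n) p q) :=
  (contMDiffAt_iff_inChart hq).mp (hF.1 q)

lemma exists_basis_orthonormal_frame (hF : IsSmoothImmersion F) (p : M) :
    ∃ b : Basis (Fin n) ℝ (EuclideanSpace ℝ (Fin n)),
      Matrix.gram ℝ (dirD b (inChart p F) (extChartAt (𝓡 n) p p)) = 1 :=
  exists_basis_gram_eq_one (by simp) (fderiv ℝ (inChart p F) (extChartAt (𝓡 n) p p)).toLinearMap
    (injective_fderiv_inChart hF (mem_chart_source _ p))

lemma eventually_inner_inChart (hF : IsSmoothImmersion F) (hν : IsUnitNormal F ν) (p : M)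
    (b : Fin n → EuclideanSpace ℝ (Fin n)) :
    ∀ᶠ y in 𝓝 (extChartAt (𝓡 n) p p), ∀ i, ⟪dirD b (inChart p F) y i, inChart p ν y⟫ = 0 :=
  eventually_nhds_extChartAt fun q hq i => by
    rw [inChart_apply ν hq]
    exact inner_fderiv_inChart hF hν hq (b i)

lemma IsUnitNormal.contMDiff (hF : IsSmoothImmersion F) (hν : IsUnitNormal F ν) :
    ContMDiff (𝓡 n) 𝓘(ℝ, Ambient n) ∞ ν := by
  intro p
  have hp := mem_chart_source (EuclideanSpace ℝ (Fin n)) p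
  obtain ⟨b, hb⟩ := exists_basis_orthonormal_frame hF p
  rw [contMDiffAt_iff_inChart hp]
  refine contDiffAt_unitNormal (b := b) (f := inChart p F) (by simp)
    (hF.contDiffAt_inChart hp) (by rw [hb]; simp) ?_ (eventually_inner_inChart hF hν p b)
    (Eventually.of_forall fun y => hν.2.1 _)
  exact hν.1.continuousAt.comp (continuousAt_extChartAt_symm p)

/-- If `⟪T y, y⟫ = lam * ‖y‖²` for all `y`, then `⟪T F, ν⟫` is in the kernel of the linearized
operator. The rotations are the case `lam = 0`, the support function is the case `T = id`. -/
theorem inKernel_of_conformal (hF : IsSelfExpander C F ν) (T : Ambient n →L[ℝ] Ambient n)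
    {lam : ℝ} (hT : ∀ y, ⟪T y, y⟫ = lam * ⟪y, y⟫) :
    InKernel C F ν (fun p => ⟪T (F p), ν p⟫) := by
  have him := hF.immersion
  have hνs := hF.unitNormal.contMDiff him
  have hφs : ContMDiff (𝓡 n) 𝓘(ℝ, ℝ) ∞ (fun p => ⟪T (F p), ν p⟫) := by
    intro p
    have hp := mem_chart_source (EuclideanSpace ℝ (Fin n)) p
    rw [contMDiffAt_iff_inChart hp]
    exact (T.contDiff.contDiffAt.comp _ (him.contDiffAt_inChart hp)).inner ℝ
      ((contMDiffAt_iff_inChart hp).mp (hνs p))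
  refine ⟨hφs, fun p => ?_⟩
  set φ : M → ℝ := fun p => ⟪T (F p), ν p⟫ with hφ
  have hp := mem_chart_source (EuclideanSpace ℝ (Fin n)) p
  obtain ⟨b, hb⟩ := exists_basis_orthonormal_frame him p
  have hFd : ∀ q ∈ (chartAt (EuclideanSpace ℝ (Fin n)) p).source,
      DifferentiableAt ℝ (inChart p F) (extChartAt (𝓡 n) p q) := fun q hq =>
    (him.contDiffAt_inChart hq).differentiableAt (by simp)
  have hνd : ∀ q ∈ (chartAt (EuclideanSpace ℝ (Fin n)) p).source,
      DifferentiableAt ℝ (inChart p ν) (extChartAt (𝓡 n) p q) := fun q hq =>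
    ((contMDiffAt_iff_inChart hq).mp (hνs q)).differentiableAt (by simp)
  have hφd : ∀ q ∈ (chartAt (EuclideanSpace ℝ (Fin n)) p).source,
      DifferentiableAt ℝ (inChart p φ) (extChartAt (𝓡 n) p q) := fun q hq =>
    ((contMDiffAt_iff_inChart hq).mp (hφs q)).differentiableAt (by simp)
  have hgrad : inChart p (surfaceGrad F φ) =ᶠ[𝓝 (extChartAt (𝓡 n) p p)]
      fun y => frameGrad (dirD b (inChart p F) y) (dirD b (inChart p φ) y) :=
    eventually_nhds_extChartAt fun q hq => by
      rw [inChart_apply _ hq, surfaceGrad_eq_frameGrad b hq (hFd q hq) (hφd q hq)]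
  have hgradd : DifferentiableAt ℝ (inChart p (surfaceGrad F φ)) (extChartAt (𝓡 n) p p) := by
    have hφc : ContDiffAt ℝ ∞ (inChart p φ) (extChartAt (𝓡 n) p p) :=
      (contMDiffAt_iff_inChart hp).mp (hφs p)
    refine DifferentiableAt.congr_of_eventuallyEq ?_ hgrad
    refine (contDiffAt_frameGrad (m := ∞) (him.contDiffAt_inChart hp) (by rw [hb]; simp)
      fun i => contDiffAt_dirD hφc i).differentiableAt (by simp)
  have hsol : ∀ᶠ y in 𝓝 (extChartAt (𝓡 n) p p),
      C * (-frameDiv (dirD b (inChart p F) y) (dirD b (inChart p ν) y))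
        * ⟪inChart p F y, inChart p ν y⟫ = -1 :=
    eventually_nhds_extChartAt fun q hq => by
      rw [← surfaceDiv_eq_frameDiv b hq (hFd q hq) (hνd q hq), inChart_apply F hq,
        inChart_apply ν hq]
      have h := hF.equation q
      rw [div_eq_iff (hF.meanCurvature_ne_zero q), meanCurvature] at h
      rw [h]; ring
  have h3 : (3 : ℕ∞ω) ≤ ∞ := WithTop.coe_le_coe.mpr (le_top (a := (3 : ℕ∞)))
  have main := local_soliton (b := b) (f := inChart p F) (N := inChart p ν) T hT
    ((him.contDiffAt_inChart hp).of_le h3)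
    (((contMDiffAt_iff_inChart hp).mp (hνs p)).of_le h3) hb
    (eq_sum_frame_normal (by simp) hb (hF.unitNormal.2.1 _)
      (eventually_inner_inChart him hF.unitNormal p b).self_of_nhds)
    (eventually_inner_inChart him hF.unitNormal p b)
    (Eventually.of_forall fun y => hF.unitNormal.2.1 _) hsol
  rw [solitonOperator, laplaceBeltrami, surfaceDiv_eq_frameDiv b hp (hFd p hp) hgradd,
    meanCurvature, surfaceDiv_eq_frameDiv b hp (hFd p hp) (hνd p hp),
    normSqA_eq_frameNormSq b hp (hFd p hp) (hνd p hp), dirD_congr hgrad,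
    surfaceGrad_eq_frameGrad b hp (hFd p hp) (hφd p hp)]
  rw [inChart_apply F hp, inChart_apply ν hp] at main
  exact main

/-- A rotation field is a skew-symmetric linear map. -/
lemma IsRotationField.exists_skew {R : Ambient n → Ambient n} (hR : IsRotationField R) :
    ∃ T : Ambient n →L[ℝ] Ambient n, (∀ x, T x = R x) ∧ ∀ y, ⟪T y, y⟫ = 0 := by
  obtain ⟨ψ, h0, hψ⟩ := hR
  have hd : ∀ x, HasDerivAt (fun s => ψ s x) (R x) 0 := fun x => by simpa [h0] using hψ 0 x
  -- `R` is the derivative at time zero of linear maps, hence linear by uniqueness of derivatives.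
  let L : Ambient n →ₗ[ℝ] Ambient n :=
    { toFun := R
      map_add' := fun x y => (hd (x + y)).unique (by simpa using (hd x).fun_add (hd y))
      map_smul' := fun c x => (hd (c • x)).unique (by simpa using (hd x).fun_const_smul c) }
  refine ⟨LinearMap.toContinuousLinearMap L, fun x => rfl, fun y => ?_⟩
  change ⟪R y, y⟫ = 0
  -- Skewness: `⟪ψ s y, ψ s y⟫` is constant in `s`, so its derivative at zero vanishes.
  have h1 := (hd y).inner ℝ (hd y)
  have h2 : (fun s => ⟪ψ s y, ψ s y⟫) = fun _ => ⟪y, y⟫ := by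
    funext s
    exact (ψ s).inner_map_map y y
  rw [h2] at h1
  have h3 := h1.unique (hasDerivAt_const 0 _)
  simp only [h0, LinearIsometryEquiv.coe_refl, id_eq] at h3
  rw [real_inner_comm] at h3
  linarith

end Kernel

end ImmersedHypersurface

end

theorem mainTheorem2 {n : ℕ} {M : Type*} [TopologicalSpace M]
    [ChartedSpace (EuclideanSpace ℝ (Fin n)) M] [IsManifold (𝓡 n) ∞ M]
    (C : ℝ) (hC : 0 < C) (F ν : M → ImmersedHypersurface.Ambient n)
    (hF : ImmersedHypersurface.IsSelfExpander C F ν) :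
    (∀ R : ImmersedHypersurface.Ambient n → ImmersedHypersurface.Ambient n,
      ImmersedHypersurface.IsRotationField R →
        ImmersedHypersurface.InKernel C F ν (fun p => ⟪R (F p), ν p⟫)) ∧
      ImmersedHypersurface.InKernel C F ν (fun p => ⟪F p, ν p⟫) := by
  refine ⟨fun R hR => ?_, ?_⟩
  · obtain ⟨T, hTR, hT⟩ := hR.exists_skew
    simpa only [hTR] using
      ImmersedHypersurface.inKernel_of_conformal hF T (lam := 0) fun y => by rw [hT, zero_mul]
  · exact ImmersedHypersurface.inKernel_of_conformal hF (ContinuousLinearMap.id ℝ _) (lam := 1)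
      fun y => (one_mul _).symm
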